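/- Let $d\ge 1$ and $N\ge 0$ be integers, and let $\widehat D\subset\mathbb{R}^d$ be the reference simplex on which the barycentric coordinates $\lambda_i=\frac{1+x_i}{2}$ ($1\le i\le d$) and $\lambda_0=1-\sum_{i=1}^d\lambda_i$ are all nonnegative. For a multi-index $\boldsymbol\alpha=(\alpha_0,\dots,\alpha_d)$ of nonnegative integers with $|\boldsymbol\alpha|=\sum_{j=0}^{d}\alpha_j=n$ let $B^n_{\boldsymbol\alpha}=\frac{n!}{\alpha_0!\cdots\alpha_d!}\lambda_0^{\alpha_0}\cdots\lambda_d^{\alpha_d}$ be the Bernstein polynomial of degree $n$. For $n\ge1$ let $\boldsymbol E^n_{n-1}$ be the one-degree elevation matrix, with rows indexed by $|\boldsymbol\beta|=n$ and columns by $|\boldsymbol\alpha|=n-1$, whose entries are $(\boldsymbol E^n_{n-1})_{\boldsymbol\beta,\boldsymbol\alpha}=\frac{\alpha_j+1}{n}$ if $\boldsymbol\beta=\boldsymbol\alpha+\boldsymbol e_j$ for some $0\le j\le d$, and $0$ otherwise. For $0\le i\le N$ let $\boldsymbol E^N_{N-i}=\boldsymbol E^N_{N-1}\boldsymbol E^{N-1}_{N-2}\cdots\boldsymbol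 E^{N-i+1}_{N-i}$ (the identity for $i=0$). Let $\{L_{\boldsymbol\gamma}\}$, $\boldsymbol\gamma\in\mathbb{Z}_{\ge0}^d$, be a hierarchical orthogonal modal basis: real polynomials in $d$ variables, orthonormal in $L^2(\widehat D)$, with $L_{\boldsymbol\gamma}$ of total degree at most $|\boldsymbol\gamma|$. Then there is exactly one matrix $\boldsymbol T_N$, with rows indexed by $|\boldsymbol\alpha|=N$ and columns by $|\boldsymbol\gamma|\le N$, that maps modal coefficients to Bernstein coefficients, i.e. $$\sum_{|\boldsymbol\gamma|\le N}c_{\boldsymbol\gamma}L_{\boldsymbol\gamma}=\sum_{|\boldsymbol\alpha|=N}(\boldsymbol T_N\boldsymbol c)_{\boldsymbol\alpha}B^N_{\boldsymbol\alpha}\qquad\text{for all real coefficient vectors }\boldsymbol c;$$ it is invertible, and the $N+1$ matrices $$\boldsymbol T_N^{-1}\,\boldsymbol E^N_{N-i}\left(\boldsymbol E^N_{N-i}\right)^T\boldsymbol T_N,\qquad 0\le i\le N,$$ form a basis of the real vector space of block-diagonal matrices $\operatorname{diag}(d_0,d_1\boldsymbol I_1,\dots,d_N\boldsymbol I_N)$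 with $d_0,\dots,d_N\in\mathbb{R}$, that is, of the diagonal matrices indexed by the modes $|\boldsymbol\gamma|\le N$ whose entry at $\boldsymbol\gamma$ depends only on $|\boldsymbol\gamma|$ (the block $\boldsymbol I_k$ consists of the modes with $|\boldsymbol\gamma|=k$). -/

import Mathlib

namespace BernsteinModal

noncomputable section

open MeasureTheory Matrix

/-- Barycentric multi-indices `α = (α₀, …, α_d)` of order `|α| = n`. -/
abbrev BernIdx (d n : ℕ) : Type := {α : Fin (d + 1) → ℕ // ∑ j, α j = n}

/-- `d`-dimensional multi-indices `γ` with `|γ| ≤ n`. -/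
abbrev ModalIdx (d n : ℕ) : Type := {γ : Fin d → ℕ // ∑ j, γ j ≤ n}

instance instFintypeBernIdx (d n : ℕ) : Fintype (BernIdx d n) :=
  Fintype.subtype (Finset.piAntidiag Finset.univ n) (by intro α; simp)

instance instFintypeModalIdx (d n : ℕ) : Fintype (ModalIdx d n) :=
  Fintype.subtype ((Finset.range (n + 1)).biUnion fun k => Finset.piAntidiag Finset.univ k)
    (by intro γ; simp)

/-- The barycentric coordinates of the reference simplex, as affine polynomials in the
coordinates `x₁, …, x_d`: `λ_i = (1 + x_i) / 2` for `1 ≤ i ≤ d` and `λ₀ = 1 - ∑ λ_i`. -/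
def bary (d : ℕ) : Fin (d + 1) → MvPolynomial (Fin d) ℝ :=
  Fin.cons
    (1 - ∑ i : Fin d, MvPolynomial.C (1 / 2 : ℝ) * (1 + MvPolynomial.X i))
    (fun i : Fin d => MvPolynomial.C (1 / 2 : ℝ) * (1 + MvPolynomial.X i))

/-- The reference simplex (bi-unit right simplex): all barycentric coordinates are
nonnegative. -/
def refSimplex (d : ℕ) : Set (Fin d → ℝ) :=
  {x | ∀ j, 0 ≤ MvPolynomial.eval x (bary d j)}

/-- The Bernstein polynomial `B^n_α = n! / (α₀! ⋯ α_d!) λ₀^α₀ ⋯ λ_d^α_d`. -/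
def bernstein (d n : ℕ) (α : BernIdx d n) : MvPolynomial (Fin d) ℝ :=
  MvPolynomial.C ((n.factorial : ℝ) / ∏ j, ((α.1 j).factorial : ℝ)) * ∏ j, bary d j ^ α.1 j

/-- The `L²` inner product of two polynomials on the reference simplex. -/
def l2Inner (d : ℕ) (p q : MvPolynomial (Fin d) ℝ) : ℝ :=
  ∫ x in refSimplex d, MvPolynomial.eval x p * MvPolynomial.eval x q

/-- A hierarchical `L²`-orthonormal modal basis `{L_γ}`. -/
structure IsModalBasis (d : ℕ) (L : (Fin d → ℕ) → MvPolynomial (Fin d) ℝ) : Prop where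
  orthonormal : ∀ γ σ : Fin d → ℕ, l2Inner d (L γ) (L σ) = if γ = σ then 1 else 0
  hierarchical : ∀ γ : Fin d → ℕ, (L γ).totalDegree ≤ ∑ j, γ j

/-- `T` maps modal coefficients to Bernstein coefficients of degree `n`:
`∑_γ c_γ L_γ = ∑_α (T c)_α B^n_α` for every coefficient vector `c`. -/
def IsModalToBernstein (d n : ℕ) (L : (Fin d → ℕ) → MvPolynomial (Fin d) ℝ)
    (T : Matrix (BernIdx d n) (ModalIdx d n) ℝ) : Prop :=
  ∀ c : ModalIdx d n → ℝ,
    ∑ γ : ModalIdx d n, c γ • L γ.1 = ∑ α : BernIdx d n, (T *ᵥ c) α • bernstein d n α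

/-- The one-degree elevation matrix `E^n_{n-1}` (used for `1 ≤ n`). Column `α` holds the
coefficients of `B^{n-1}_α = ∑_j (α_j + 1) / n B^n_{α + e_j}`. -/
def elevOne (d n : ℕ) : Matrix (BernIdx d n) (BernIdx d (n - 1)) ℝ :=
  Matrix.of fun β α =>
    ∑ j : Fin (d + 1), if β.1 = α.1 + Pi.single j 1 then ((α.1 j : ℝ) + 1) / (n : ℝ) else 0

/-- The degree elevation matrix
`E^n_{n-i} = E^n_{n-1} E^{n-1}_{n-2} ⋯ E^{n-i+1}_{n-i}` (used for `i ≤ n`). -/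
def elev (d n : ℕ) : (i : ℕ) → Matrix (BernIdx d n) (BernIdx d (n - i)) ℝ
  | 0 => (1 : Matrix (BernIdx d n) (BernIdx d n) ℝ)
  | i + 1 => elev d n i * elevOne d (n - i)

/-- The space of block-diagonal matrices `diag(d₀, d₁ I₁, …, d_n I_n)`: diagonal matrices,
indexed by the modes `γ` with `|γ| ≤ n`, whose entry at `γ` depends only on `|γ|`. -/
def blockScalar (d n : ℕ) : Submodule ℝ (Matrix (ModalIdx d n) (ModalIdx d n) ℝ) where
  carrier := {D | ∃ c : ℕ → ℝ, D = Matrix.diagonal fun γ : ModalIdx d n => c (∑ j, γ.1 j)}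
  add_mem' := by
    rintro _ _ ⟨a, rfl⟩ ⟨b, rfl⟩
    exact ⟨a + b, by rw [Matrix.diagonal_add]; rfl⟩
  zero_mem' := ⟨0, by ext i j; simp [Matrix.diagonal_apply]⟩
  smul_mem' := by
    rintro r _ ⟨a, rfl⟩
    exact ⟨r • a, by rw [← Matrix.diagonal_smul]; rfl⟩

end

end BernsteinModal

namespace BernsteinModal

noncomputable section

open MeasureTheory Matrix

/-! ### Moments of barycentric coordinates and their recurrence. -/

section Moments

open MvPolynomial

/-! Represent a polynomial of degree at most `n` on the simplex by a form of degree `n` in `λ_0, …,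
λ_d`. On such forms elevation is multiplication by `∑ λ_j = 1` (`bernHom_elevOne`), while the
transpose of one-degree elevation is, up to the factor `n²`, the operator `A = ∑ ∂_j λ_j ∂_j`
(`baryLaplace_bernHom`).

The operator `A` depends on the representative, and its failure to be symmetric is explicit: for
forms `P`, `Q` of degrees `n`, `m`, `⟨AP, Q⟩ - ⟨P, AQ⟩ = (n(n+d) - m(m+d)) ⟨P, Q⟩`
(`l2Form_baryLaplace_bernHom`). This rests on a recurrence for the moments (`moment_add_single`).
Since `A` lowers degree, orthogonality makes each `L_γ` with `|γ| = k`, written in degree `n`, an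
eigenfunction with eigenvalue `n(n+d) - k(k+d)` (`IsModalBasis.baryLaplace_eigen`).

Iterating, `E Eᵀ` acts on the mode by a product over the degrees `n, n-1, …, n-i+1`, which vanishes
exactly when `k > n-i`. With `k` listed in decreasing order these eigenvalues form a triangular
matrix with nonzero diagonal, whence the basis. -/

lemma eval_bary_zero {d : ℕ} (x : Fin d → ℝ) :
    eval x (bary d 0) = 1 - ∑ i, (1 + x i) / 2 := by
  simp [bary, div_eq_inv_mul]

lemma eval_bary_succ {d : ℕ} (x : Fin d → ℝ) (i : Fin d) :
    eval x (bary d i.succ) = (1 + x i) / 2 := by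
  simp [bary, div_eq_inv_mul]

lemma sum_bary (d : ℕ) : ∑ j, bary d j = 1 := by
  simp [bary, Fin.sum_univ_succ]

lemma mem_refSimplex {d : ℕ} {x : Fin d → ℝ} :
    x ∈ refSimplex d ↔ ∑ i, (1 + x i) / 2 ≤ 1 ∧ ∀ i, -1 ≤ x i := by
  simp only [refSimplex, Set.mem_ofPred_eq, Fin.forall_fin_succ, eval_bary_zero, eval_bary_succ,
    sub_nonneg]
  refine and_congr_right fun _ => forall_congr' fun i => ?_
  constructor <;> intro h <;> linarith

lemma isCompact_refSimplex (d : ℕ) : IsCompact (refSimplex d) := by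
  have hclosed : IsClosed (refSimplex d) := by
    rw [refSimplex, Set.ofPred_forall]
    exact isClosed_iInter fun j => isClosed_le continuous_const (continuous_eval _)
  refine (isCompact_Icc (a := fun _ : Fin d => (-1 : ℝ)) (b := fun _ => 1)).of_isClosed_subset
    hclosed fun x hx => ?_
  rw [mem_refSimplex] at hx
  refine ⟨fun i => hx.2 i, fun i => ?_⟩
  have h := Finset.single_le_sum (f := fun i => (1 + x i) / 2)
    (fun j _ => by have := hx.2 j; linarith) (Finset.mem_univ i)
  have := h.trans hx.1
  linarith

lemma integrableOn_refSimplex {d : ℕ} {f : (Fin d → ℝ) → ℝ} (hf : Continuous f) :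
    IntegrableOn f (refSimplex d) :=
  hf.continuousOn.integrableOn_compact (isCompact_refSimplex d)

/-- The integral over the simplex of a partial derivative `∂_i F` vanishes when `F` vanishes on
the two faces `λ_i = 0` and `λ₀ = 0`. -/
lemma setIntegral_refSimplex_eq_zero {m : ℕ} (i : Fin (m + 1)) {F f : (Fin (m + 1) → ℝ) → ℝ}
    (hf : Continuous f)
    (hF : ∀ (y : Fin m → ℝ) t, HasDerivAt (fun s => F (i.insertNth s y)) (f (i.insertNth t y)) t)
    (h0 : ∀ x, eval x (bary (m + 1) 0) = 0 → F x = 0)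
    (hi : ∀ x, eval x (bary (m + 1) i.succ) = 0 → F x = 0) :
    ∫ x in refSimplex (m + 1), f x = 0 := by
  have hmeas : MeasurableSet (refSimplex (m + 1)) := (isCompact_refSimplex _).measurableSet
  rw [← integral_indicator hmeas]
  have e := (volume_preserving_piFinSuccAbove (fun _ : Fin (m + 1) => ℝ) i).symm
  rw [← e.integral_comp']
  have hint : Integrable ((refSimplex (m + 1)).indicator f) :=
    (integrable_indicator_iff hmeas).2 (integrableOn_refSimplex hf)
  have hint' := (e.integrable_comp_emb (MeasurableEquiv.measurableEmbedding _)).2 hint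
  rw [Measure.volume_eq_prod, integral_prod_symm]
  swap
  · exact hint'
  -- Coordinate `i` is integrated first. Each slice is empty or an interval running from the face
  -- `λ_i = 0` to the face `λ_0 = 0`, so the inner integral is a difference of two zero values of
  -- `F`.
  refine integral_eq_zero_of_ae (Filter.Eventually.of_forall fun y => ?_)
  have hmem : ∀ t, i.insertNth t y ∈ refSimplex (m + 1) ↔
      t ∈ Set.Icc (-1) (1 - ∑ j, (1 + y j)) ∧ ∀ j, -1 ≤ y j := by
    intro t
    rw [mem_refSimplex, Fin.sum_univ_succAbove _ i, Fin.forall_iff_succAbove i]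
    simp only [Fin.insertNth_apply_same, Fin.insertNth_apply_succAbove, Set.mem_Icc,
      ← Finset.sum_div]
    constructor
    · rintro ⟨h1, h2, h3⟩
      exact ⟨⟨h2, by linarith⟩, h3⟩
    · rintro ⟨⟨h1, h2⟩, h3⟩
      exact ⟨by linarith, h1, h3⟩
  change ∫ t, (refSimplex (m + 1)).indicator f (i.insertNth t y) = 0
  by_cases hy : (∀ j, -1 ≤ y j) ∧ -1 ≤ 1 - ∑ j, (1 + y j)
  · have hind : (fun t => (refSimplex (m + 1)).indicator f (i.insertNth t y)) =
        (Set.Icc (-1) (1 - ∑ j, (1 + y j))).indicator fun t => f (i.insertNth t y) := by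
      funext t
      by_cases ht : t ∈ Set.Icc (-1) (1 - ∑ j, (1 + y j))
      · rw [Set.indicator_of_mem ht, Set.indicator_of_mem ((hmem t).2 ⟨ht, hy.1⟩)]
      · rw [Set.indicator_of_notMem ht, Set.indicator_of_notMem fun h => ht ((hmem t).1 h).1]
    have hcont : Continuous fun t : ℝ => f (i.insertNth t y) :=
      hf.comp (Continuous.finInsertNth i continuous_id continuous_const)
    rw [hind, integral_indicator measurableSet_Icc, integral_Icc_eq_integral_Ioc,
      ← intervalIntegral.integral_of_le hy.2,
      intervalIntegral.integral_eq_sub_of_hasDerivAt (fun t _ => hF y t)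
        (hcont.intervalIntegrable _ _), h0, hi, sub_zero]
    · simp [eval_bary_succ]
    · rw [eval_bary_zero, Fin.sum_univ_succAbove _ i]
      simp only [Fin.insertNth_apply_same, Fin.insertNth_apply_succAbove, ← Finset.sum_div]
      ring
  · have hind : (fun t => (refSimplex (m + 1)).indicator f (i.insertNth t y)) = fun _ => 0 := by
      funext t
      refine Set.indicator_of_notMem (fun h => hy ?_) _
      rw [hmem] at h
      exact ⟨h.2, h.1.1.trans h.1.2⟩
    rw [hind, integral_zero]

/-- The moments of the barycentric coordinates on the reference simplex. -/
def moment (d : ℕ) (ε : Fin (d + 1) → ℕ) : ℝ :=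
  ∫ x in refSimplex d, ∏ j, eval x (bary d j) ^ ε j

lemma continuous_prod_eval_bary {d : ℕ} (ε : Fin (d + 1) → ℕ) :
    Continuous fun x => ∏ j, eval x (bary d j) ^ ε j :=
  continuous_finsetProd _ fun _ _ => (continuous_eval _).pow _

lemma sum_moment_add_single {d : ℕ} (ε : Fin (d + 1) → ℕ) :
    ∑ k, moment d (ε + Pi.single k 1) = moment d ε := by
  simp only [moment]
  rw [← integral_finsetSum _ fun k _ => integrableOn_refSimplex (continuous_prod_eval_bary _)]
  congr 1
  funext x
  have h : ∀ k, ∏ j, eval x (bary d j) ^ (ε + Pi.single k 1 : Fin (d + 1) → ℕ) j =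
      (∏ j, eval x (bary d j) ^ ε j) * eval x (bary d k) := by
    intro k
    simp only [Pi.add_apply, pow_add, Finset.prod_mul_distrib, Pi.single_apply]
    simp [pow_ite]
  simp only [h]
  rw [← Finset.mul_sum, ← map_sum, sum_bary, map_one, mul_one]

lemma moment_add_single_zero {d : ℕ} (ε : Fin (d + 1) → ℕ) (i : Fin d) :
    ((ε i.succ : ℝ) + 1) * moment d (ε + Pi.single 0 1) =
      ((ε 0 : ℝ) + 1) * moment d (ε + Pi.single i.succ 1) := by
  obtain _ | m := d
  · exact i.elim0
  -- Along `x_i` only `λ_i` and `λ_0` vary, with derivatives `1/2` and `-1/2`; the factor 2 cancels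
  -- these. Raising both exponents by one makes `F` vanish on the two faces.
  have key := setIntegral_refSimplex_eq_zero i
    (F := fun x => 2 * (eval x (bary (m + 1) i.succ) ^ (ε i.succ + 1) *
      eval x (bary (m + 1) 0) ^ (ε 0 + 1) *
        ∏ j, eval x (bary (m + 1) (i.succAbove j).succ) ^ ε (i.succAbove j).succ))
    (f := fun x => ((ε i.succ : ℝ) + 1) *
        (∏ j, eval x (bary (m + 1) j) ^ (ε + Pi.single 0 1 : Fin (m + 2) → ℕ) j) -
      ((ε 0 : ℝ) + 1) * (∏ j, eval x (bary (m + 1) j) ^ (ε + Pi.single i.succ 1 : Fin (m + 2) → ℕ) j))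
    ?_ ?_ ?_ ?_
  · rw [integral_sub, integral_const_mul, integral_const_mul, sub_eq_zero] at key
    · exact key
    · exact (integrableOn_refSimplex (continuous_prod_eval_bary _)).const_mul _
    · exact (integrableOn_refSimplex (continuous_prod_eval_bary _)).const_mul _
  · exact (continuous_const.mul (continuous_prod_eval_bary _)).sub
      (continuous_const.mul (continuous_prod_eval_bary _))
  · intro y t
    have hsucc : ∀ s, eval (i.insertNth s y : Fin (m + 1) → ℝ) (bary (m + 1) i.succ)
        = (1 + s) / 2 := by
      intro s; simp [eval_bary_succ]
    have hzero : ∀ s, eval (i.insertNth s y : Fin (m + 1) → ℝ) (bary (m + 1) 0)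
        = 1 - (1 + s) / 2 - ∑ j, (1 + y j) / 2 := by
      intro s
      rw [eval_bary_zero, Fin.sum_univ_succAbove _ i]
      simp only [Fin.insertNth_apply_same, Fin.insertNth_apply_succAbove]
      ring
    have hoth : ∀ s j, eval (i.insertNth s y : Fin (m + 1) → ℝ) (bary (m + 1) (i.succAbove j).succ)
        = (1 + y j) / 2 := by
      intro s j; simp [eval_bary_succ]
    have h1 : HasDerivAt (fun s : ℝ => (1 + s) / 2) (1 / 2) t :=
      ((hasDerivAt_id t).const_add 1).div_const 2
    have h2 : HasDerivAt (fun s : ℝ => 1 - (1 + s) / 2 - ∑ j, (1 + y j) / 2) (-(1 / 2)) t :=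
      (h1.const_sub 1).sub_const _
    have h3 := (((h1.pow (ε i.succ + 1)).mul (h2.pow (ε 0 + 1))).mul_const
      (∏ j, ((1 + y j) / 2) ^ ε (i.succAbove j).succ)).const_mul 2
    have hne : ∀ j, (i.succAbove j).succ ≠ i.succ := fun j h =>
      Fin.succAbove_ne i j (Fin.succ_injective _ h)
    simp only [Fin.prod_univ_succ, Fin.prod_univ_succAbove _ i, hsucc, hzero, hoth]
    refine h3.congr_deriv ?_
    simp only [Pi.add_apply, Pi.single_apply, hne, Fin.succ_ne_zero, (Fin.succ_ne_zero _).symm,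
      if_true, if_false, add_zero, pow_succ, Nat.add_sub_cancel, Nat.cast_add, Nat.cast_one,
      Pi.pow_apply]
    ring
  · intro x hx
    simp [hx]
  · intro x hx
    simp [hx]

lemma moment_add_single_comm {d : ℕ} (ε : Fin (d + 1) → ℕ) (j k : Fin (d + 1)) :
    ((ε j : ℝ) + 1) * moment d (ε + Pi.single k 1) =
      ((ε k : ℝ) + 1) * moment d (ε + Pi.single j 1) := by
  have h : ∀ j, ((ε j : ℝ) + 1) * moment d (ε + Pi.single 0 1) =
      ((ε 0 : ℝ) + 1) * moment d (ε + Pi.single j 1) := by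
    intro j
    refine Fin.cases rfl (fun i => ?_) j
    exact moment_add_single_zero ε i
  have hpos : ((ε 0 : ℝ) + 1) ≠ 0 := by positivity
  apply mul_left_cancel₀ hpos
  linear_combination ((ε k : ℝ) + 1) * h j - ((ε j : ℝ) + 1) * h k

/-- Expand `moment d ε` by `∑ λ_k = 1`, then convert every term to direction `j` by
`moment_add_single_comm`. Only this ratio of moments is needed below, never their closed form. -/
lemma moment_add_single {d : ℕ} (ε : Fin (d + 1) → ℕ) (j : Fin (d + 1)) :
    ((∑ k, ε k : ℕ) + 1 + d : ℝ) * moment d (ε + Pi.single j 1) = ((ε j : ℝ) + 1) * moment d ε := by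
  rw [← sum_moment_add_single ε, Finset.mul_sum]
  simp only [moment_add_single_comm ε j]
  rw [← Finset.sum_mul, Finset.sum_add_distrib]
  congr 1
  simp
  ring

end Moments

/-! ### The operator `∑ ∂_j λ_j ∂_j` and its defect of symmetry. -/

section Adjoint

open MvPolynomial

/-- The `L²` inner product on the reference simplex as a bilinear form. -/
def l2Form (d : ℕ) : LinearMap.BilinForm ℝ (MvPolynomial (Fin d) ℝ) :=
  LinearMap.mk₂ ℝ (l2Inner d)
    (fun p q r => by
      simp only [l2Inner, map_add, add_mul]
      exact integral_add (integrableOn_refSimplex ((continuous_eval p).mul (continuous_eval r)))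
        (integrableOn_refSimplex ((continuous_eval q).mul (continuous_eval r))))
    (fun c p q => by
      simp only [l2Inner, smul_eval, mul_assoc]
      exact integral_const_mul _ _)
    (fun p q r => by
      simp only [l2Inner, map_add, mul_add]
      exact integral_add (integrableOn_refSimplex ((continuous_eval p).mul (continuous_eval q)))
        (integrableOn_refSimplex ((continuous_eval p).mul (continuous_eval r))))
    (fun c p q => by
      simp only [l2Inner, smul_eval, mul_left_comm]
      exact integral_const_mul _ _)

lemma l2Form_apply {d : ℕ} (p q : MvPolynomial (Fin d) ℝ) : l2Form d p q = l2Inner d p q := rfl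

lemma l2Form_comm {d : ℕ} (p q : MvPolynomial (Fin d) ℝ) : l2Form d p q = l2Form d q p := by
  simp only [l2Form_apply, l2Inner, mul_comm]

/-- Substitution of the barycentric coordinates for `d + 1` variables. -/
def fromBary (d : ℕ) : MvPolynomial (Fin (d + 1)) ℝ →ₐ[ℝ] MvPolynomial (Fin d) ℝ :=
  aeval (bary d)

/-- The operator `∑_j ∂_j λ_j ∂_j` on polynomials in barycentric variables. -/
def baryLaplace (d : ℕ) :
    MvPolynomial (Fin (d + 1)) ℝ →ₗ[ℝ] MvPolynomial (Fin (d + 1)) ℝ :=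
  ∑ j, (pderiv j).toLinearMap ∘ₗ LinearMap.mulLeft ℝ (X j) ∘ₗ (pderiv j).toLinearMap

lemma baryLaplace_monomial {d : ℕ} (s : Fin (d + 1) →₀ ℕ) (a : ℝ) :
    baryLaplace d (monomial s a) =
      ∑ j, monomial (s - Finsupp.single j 1) (a * (s j : ℝ) ^ 2) := by
  simp only [baryLaplace, LinearMap.sum_apply, LinearMap.comp_apply, LinearMap.mulLeft_apply,
    Derivation.coeFn_coe]
  refine Finset.sum_congr rfl fun j _ => ?_
  rw [X_mul_pderiv_monomial, map_nsmul, pderiv_monomial, ← map_nsmul, nsmul_eq_mul]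
  congr 1
  ring

lemma fromBary_monomial {d : ℕ} (s : Fin (d + 1) →₀ ℕ) (a : ℝ) :
    fromBary d (monomial s a) = C a * ∏ j, bary d j ^ s j := by
  rw [fromBary, aeval_monomial, Finsupp.prod_fintype _ _ fun _ => pow_zero _]
  rfl

lemma l2Form_fromBary_monomial {d : ℕ} (s t : Fin (d + 1) →₀ ℕ) (a b : ℝ) :
    l2Form d (fromBary d (monomial s a)) (fromBary d (monomial t b)) =
      a * b * moment d (⇑s + ⇑t) := by
  rw [l2Form_apply, l2Inner, moment, ← integral_const_mul]
  congr 1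
  funext x
  simp only [fromBary_monomial, map_mul, eval_C, map_prod, map_pow, Pi.add_apply, pow_add,
    Finset.prod_mul_distrib]
  ring

/-- This is `moment_add_single` at exponent `s - e_j + t`, cleared of denominators. The extra factor
`s j` covers `s j = 0`, where the truncated subtraction would be wrong. -/
lemma moment_sub_single {d : ℕ} (s t : Fin (d + 1) →₀ ℕ) (j : Fin (d + 1)) :
    (s j : ℝ) * (s j + t j) * moment d (⇑(s - Finsupp.single j 1 : Fin (d + 1) →₀ ℕ) + ⇑t) =
      s j * ((∑ k, s k : ℕ) + (∑ k, t k : ℕ) + d) * moment d (⇑s + ⇑t) := by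
  by_cases hs : s j = 0
  · simp [hs]
  obtain ⟨u, rfl⟩ : ∃ u, s = u + Finsupp.single j 1 :=
    ⟨s - Finsupp.single j 1, (tsub_add_cancel_of_le (by simpa using Nat.one_le_iff_ne_zero.2 hs)).symm⟩
  have h := moment_add_single (⇑u + ⇑t) j
  have h1 : (⇑(u + Finsupp.single j 1 : Fin (d + 1) →₀ ℕ) + ⇑t : Fin (d + 1) → ℕ) = ⇑u + ⇑t + Pi.single j 1 := by
    rw [Finsupp.coe_add, Finsupp.single_eq_pi_single]
    abel
  have h2 : ∑ k, (u + Finsupp.single j 1 : Fin (d + 1) →₀ ℕ) k = ∑ k, u k + 1 := by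
    simp [Finset.sum_add_distrib, Finsupp.single_apply]
  rw [add_tsub_cancel_right, h1, h2]
  simp only [Pi.add_apply, Finset.sum_add_distrib, Nat.cast_add, Nat.cast_one, Finsupp.add_apply,
    Finsupp.single_eq_same] at h ⊢
  linear_combination -((u j : ℝ) + 1) * h

/-- After division by `s j + t j`, the identity is `(s_j² - t_j²) / (s_j + t_j) = s_j - t_j`. -/
lemma sq_mul_moment_sub {d : ℕ} (s t : Fin (d + 1) →₀ ℕ) (j : Fin (d + 1)) :
    (s j : ℝ) ^ 2 * moment d (⇑(s - Finsupp.single j 1 : Fin (d + 1) →₀ ℕ) + ⇑t) -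
        (t j : ℝ) ^ 2 * moment d (⇑s + ⇑(t - Finsupp.single j 1 : Fin (d + 1) →₀ ℕ)) =
      ((s j : ℝ) - t j) * ((∑ k, s k : ℕ) + (∑ k, t k : ℕ) + d) * moment d (⇑s + ⇑t) := by
  by_cases h0 : s j + t j = 0
  · simp [(Nat.add_eq_zero_iff.1 h0).1, (Nat.add_eq_zero_iff.1 h0).2]
  have h1 := moment_sub_single s t j
  have h2 := moment_sub_single t s j
  rw [add_comm (⇑t), add_comm (⇑(t - _))] at h2
  have h3 : (s j : ℝ) + t j ≠ 0 := by exact_mod_cast h0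
  apply mul_left_cancel₀ h3
  linear_combination (s j : ℝ) * h1 - (t j : ℝ) * h2

/-- Summing `sq_mul_moment_sub` over `j` gives `(|s| - |t|)(|s| + |t| + d) = |s|(|s| + d) - |t|(|t|
+ d)`, which depends on the degrees alone and so extends to forms. -/
lemma l2Form_baryLaplace_monomial {d : ℕ} (s t : Fin (d + 1) →₀ ℕ) (a b : ℝ) :
    l2Form d (fromBary d (baryLaplace d (monomial s a))) (fromBary d (monomial t b)) -
        l2Form d (fromBary d (monomial s a)) (fromBary d (baryLaplace d (monomial t b))) =
      (((∑ k, s k : ℕ) : ℝ) * ((∑ k, s k : ℕ) + d) - (∑ k, t k : ℕ) * ((∑ k, t k : ℕ) + d)) *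
        l2Form d (fromBary d (monomial s a)) (fromBary d (monomial t b)) := by
  simp only [baryLaplace_monomial, map_sum, LinearMap.sum_apply, l2Form_fromBary_monomial]
  rw [← Finset.sum_sub_distrib]
  have h : ∀ j, a * (s j : ℝ) ^ 2 * b * moment d (⇑(s - Finsupp.single j 1 : Fin (d + 1) →₀ ℕ) + ⇑t) -
      a * (b * (t j : ℝ) ^ 2) * moment d (⇑s + ⇑(t - Finsupp.single j 1 : Fin (d + 1) →₀ ℕ)) =
      ((s j : ℝ) - t j) *
        (a * b * ((∑ k, s k : ℕ) + (∑ k, t k : ℕ) + d) * moment d (⇑s + ⇑t)) := fun j => by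
    linear_combination a * b * sq_mul_moment_sub s t j
  simp only [h]
  rw [← Finset.sum_mul, Finset.sum_sub_distrib]
  push_cast
  ring

/-- The homogeneous polynomial in barycentric variables with Bernstein coefficients `c`. -/
def bernHom (d n : ℕ) : (BernIdx d n → ℝ) →ₗ[ℝ] MvPolynomial (Fin (d + 1)) ℝ :=
  ∑ β : BernIdx d n, (monomial (Finsupp.equivFunOnFinite.symm β.1) ∘ₗ
    LinearMap.mulLeft ℝ ((n.factorial : ℝ) / ∏ j, ((β.1 j).factorial : ℝ))) ∘ₗ LinearMap.proj β

lemma bernHom_apply {d n : ℕ} (c : BernIdx d n → ℝ) :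
    bernHom d n c = ∑ β : BernIdx d n, monomial (Finsupp.equivFunOnFinite.symm β.1)
      ((n.factorial : ℝ) / (∏ j, ((β.1 j).factorial : ℝ)) * c β) := by
  simp [bernHom]

lemma fromBary_bernHom {d n : ℕ} (c : BernIdx d n → ℝ) :
    fromBary d (bernHom d n c) = ∑ β, c β • bernstein d n β := by
  simp only [bernHom_apply, map_sum, fromBary_monomial, bernstein, smul_eq_C_mul, map_mul,
    Finsupp.equivFunOnFinite_symm_apply_apply]
  refine Finset.sum_congr rfl fun β _ => ?_
  ring

lemma l2Form_baryLaplace_bernHom {d n m : ℕ} (c : BernIdx d n → ℝ) (e : BernIdx d m → ℝ) :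
    l2Form d (fromBary d (baryLaplace d (bernHom d n c))) (fromBary d (bernHom d m e)) -
        l2Form d (fromBary d (bernHom d n c)) (fromBary d (baryLaplace d (bernHom d m e))) =
      ((n : ℝ) * (n + d) - m * (m + d)) *
        l2Form d (fromBary d (bernHom d n c)) (fromBary d (bernHom d m e)) := by
  simp only [bernHom_apply, map_sum, LinearMap.sum_apply, Finset.mul_sum,
    ← Finset.sum_sub_distrib]
  refine Finset.sum_congr rfl fun β _ => Finset.sum_congr rfl fun α _ => ?_
  rw [l2Form_baryLaplace_monomial]
  simp only [Finsupp.equivFunOnFinite_symm_apply_apply, β.2, α.2]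

end Adjoint

/-! ### Elevation as multiplication, its transpose as differentiation. -/

section Elevation

open MvPolynomial

/-- The multi-index `α + e_j`. -/
def BernIdx.addSingle {d n : ℕ} (α : BernIdx d n) (j : Fin (d + 1)) : BernIdx d (n + 1) :=
  ⟨α.1 + Pi.single j 1, by simp [Finset.sum_add_distrib, α.2]⟩

lemma BernIdx.exists_addSingle_eq {d n : ℕ} (β : BernIdx d (n + 1)) {j : Fin (d + 1)}
    (h : β.1 j ≠ 0) : ∃ α : BernIdx d n, α.addSingle j = β := by
  have hβ : β.1 - Pi.single j 1 + Pi.single j 1 = β.1 := by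
    funext k
    by_cases hk : k = j
    · subst hk
      simp only [Pi.add_apply, Pi.sub_apply, Pi.single_eq_same]
      omega
    · simp [hk]
  refine ⟨⟨β.1 - Pi.single j 1, ?_⟩, Subtype.ext hβ⟩
  have h1 := β.2
  rw [← hβ] at h1
  simpa [Finset.sum_add_distrib] using h1

lemma BernIdx.addSingle_left_injective {d n : ℕ} (j : Fin (d + 1)) :
    Function.Injective fun α : BernIdx d n => α.addSingle j := fun _ _ h =>
  Subtype.ext (add_right_cancel (congrArg Subtype.val h))

lemma prod_factorial_addSingle {d n : ℕ} (α : BernIdx d n) (j : Fin (d + 1)) :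
    ∏ k, (((α.addSingle j).1 k).factorial : ℝ) = (α.1 j + 1) * ∏ k, ((α.1 k).factorial : ℝ) := by
  have h : ∀ k, (((α.addSingle j).1 k).factorial : ℝ) =
      (if k = j then (α.1 j + 1 : ℝ) else 1) * ((α.1 k).factorial : ℝ) := by
    intro k
    by_cases hk : k = j
    · subst hk
      simp [BernIdx.addSingle, Nat.factorial_succ]
    · simp [BernIdx.addSingle, hk]
  simp only [h, Finset.prod_mul_distrib]
  simp

lemma elevOne_succ_apply {d n : ℕ} (β : BernIdx d (n + 1)) (α : BernIdx d n) :
    elevOne d (n + 1) β α =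
      ∑ j, if β = α.addSingle j then ((α.1 j : ℝ) + 1) / (n + 1 : ℝ) else 0 := by
  simp only [elevOne, Matrix.of_apply, Subtype.ext_iff, BernIdx.addSingle, Nat.cast_add,
    Nat.cast_one]

lemma toFinsupp_addSingle {d n : ℕ} (α : BernIdx d n) (j : Fin (d + 1)) :
    Finsupp.equivFunOnFinite.symm (α.addSingle j).1 =
      Finsupp.equivFunOnFinite.symm α.1 + Finsupp.single j 1 := by
  ext k
  simp [BernIdx.addSingle, Finsupp.single_eq_pi_single]

lemma bernHom_elevOne {d n : ℕ} (a : BernIdx d n → ℝ) :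
    bernHom d (n + 1) (elevOne d (n + 1) *ᵥ a) = (∑ j, X j) * bernHom d n a := by
  have h1 : ∀ β, (elevOne d (n + 1) *ᵥ a) β = ∑ α : BernIdx d n, ∑ j,
      if β = α.addSingle j then ((α.1 j : ℝ) + 1) / (n + 1 : ℝ) * a α else 0 := by
    intro β
    refine Finset.sum_congr rfl fun α _ => ?_
    change elevOne d (n + 1) β α * a α = _
    rw [elevOne_succ_apply, Finset.sum_mul]
    simp only [ite_mul, zero_mul]
  simp only [bernHom_apply, h1, Finset.mul_sum, map_sum, Finset.sum_mul]
  rw [Finset.sum_comm]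
  refine Finset.sum_congr rfl fun α _ => ?_
  rw [Finset.sum_comm]
  refine Finset.sum_congr rfl fun j _ => ?_
  simp only [mul_zero, apply_ite, map_zero]
  rw [Finset.sum_ite_eq' Finset.univ, if_pos (Finset.mem_univ _), toFinsupp_addSingle,
    prod_factorial_addSingle, mul_comm (X j), X, monomial_mul, mul_one,
    Nat.factorial_succ]
  congr 1
  have h3 : (∏ k, ((α.1 k).factorial : ℝ)) ≠ 0 :=
    Finset.prod_ne_zero_iff.2 fun k _ => by positivity
  push_cast
  field_simp

lemma fromBary_bernHom_elevOne {d n : ℕ} (hn : n ≠ 0) (a : BernIdx d (n - 1) → ℝ) :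
    fromBary d (bernHom d n (elevOne d n *ᵥ a)) = fromBary d (bernHom d (n - 1) a) := by
  obtain ⟨m, rfl⟩ := Nat.exists_eq_succ_of_ne_zero hn
  have h := bernHom_elevOne (d := d) (n := m) a
  have h2 : fromBary d (∑ j, X j) = 1 := by simp [fromBary, sum_bary]
  refine (congrArg (fromBary d) h).trans ?_
  rw [map_mul, h2, one_mul]
  rfl

/-- For `β = α + e_j`, differentiation yields `β_j² (n+1)!/β!`, which equals `(n+1)² · (α_j+1)/(n+1)
· n!/α!`: an entry of the elevation matrix, now summed over its row index. -/
lemma baryLaplace_bernHom_succ {d n : ℕ} (c : BernIdx d (n + 1) → ℝ) :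
    baryLaplace d (bernHom d (n + 1) c) =
      ((n + 1 : ℝ) ^ 2) • bernHom d n ((elevOne d (n + 1))ᵀ *ᵥ c) := by
  have h1 : ∀ α : BernIdx d n, ((elevOne d (n + 1))ᵀ *ᵥ c) α =
      ∑ β : BernIdx d (n + 1), ∑ j,
        if β = α.addSingle j then ((α.1 j : ℝ) + 1) / (n + 1 : ℝ) * c β else 0 := by
    intro α
    refine Finset.sum_congr rfl fun β _ => ?_
    change elevOne d (n + 1) β α * c β = _
    rw [elevOne_succ_apply, Finset.sum_mul]
    simp only [ite_mul, zero_mul]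
  simp only [bernHom_apply, h1, Finset.mul_sum, map_sum, Finset.smul_sum, baryLaplace_monomial]
  rw [Finset.sum_comm (s := (Finset.univ : Finset (BernIdx d n)))]
  refine Finset.sum_congr rfl fun β _ => ?_
  rw [Finset.sum_comm]
  refine Finset.sum_congr rfl fun j _ => ?_
  by_cases hβ : β.1 j = 0
  · rw [Finset.sum_eq_zero]
    · simp [hβ]
    · intro α _
      rw [if_neg]
      · simp
      · rintro rfl
        simp [BernIdx.addSingle] at hβ
  · obtain ⟨α, rfl⟩ := β.exists_addSingle_eq hβ
    rw [Finset.sum_eq_single α]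
    · have h3 : (∏ k, ((α.1 k).factorial : ℝ)) ≠ 0 :=
        Finset.prod_ne_zero_iff.2 fun k _ => by positivity
      have h4 : (α.1 j : ℝ) + 1 ≠ 0 := by positivity
      have h5 : (n : ℝ) + 1 ≠ 0 := by positivity
      rw [if_pos rfl, toFinsupp_addSingle, add_tsub_cancel_right, smul_monomial,
        prod_factorial_addSingle, Nat.factorial_succ]
      congr 1
      simp only [Finsupp.add_apply, Finsupp.equivFunOnFinite_symm_apply_apply,
        Finsupp.single_eq_same, smul_eq_mul]
      push_cast
      field_simp
    · intro α' _ hne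
      rw [if_neg]
      · simp
      · exact fun h => hne (BernIdx.addSingle_left_injective j h).symm
    · simp

lemma baryLaplace_bernHom {d n : ℕ} (hn : n ≠ 0) (c : BernIdx d n → ℝ) :
    baryLaplace d (bernHom d n c) =
      ((n : ℝ) ^ 2) • bernHom d (n - 1) ((elevOne d n)ᵀ *ᵥ c) := by
  obtain ⟨m, rfl⟩ := Nat.exists_eq_succ_of_ne_zero hn
  simpa using baryLaplace_bernHom_succ c

lemma baryLaplace_bernHom_zero {d : ℕ} (c : BernIdx d 0 → ℝ) :
    baryLaplace d (bernHom d 0 c) = 0 := by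
  simp only [bernHom_apply, map_sum, baryLaplace_monomial]
  refine Finset.sum_eq_zero fun β _ => Finset.sum_eq_zero fun j _ => ?_
  have h : β.1 j = 0 := (Finset.sum_eq_zero_iff.1 β.2) j (Finset.mem_univ j)
  simp [h]

end Elevation

/-! ### Bernstein polynomials and modes span the same space. -/

section Spans

open MvPolynomial

/-- Dropping `α₀` identifies barycentric multi-indices of order `n` with modal ones. -/
def bernIdxEquivModalIdx (d n : ℕ) : BernIdx d n ≃ ModalIdx d n where
  toFun α := ⟨Fin.tail α.1, by
    have h := α.2
    rw [Fin.sum_univ_succ] at h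
    exact (Nat.le_add_left _ _).trans h.le⟩
  invFun γ := ⟨Fin.cons (n - ∑ j, γ.1 j) γ.1, by
    rw [Fin.sum_univ_succ]
    simpa using Nat.sub_add_cancel γ.2⟩
  left_inv α := by
    apply Subtype.ext
    have h := α.2
    rw [Fin.sum_univ_succ] at h
    have h0 : n - ∑ j : Fin d, α.1 j.succ = α.1 0 := by omega
    simp only [Fin.tail, h0]
    exact Fin.cons_self_tail α.1
  right_inv γ := by
    apply Subtype.ext
    simp

lemma fromBary_mem_span_bernstein {d n : ℕ} {P : MvPolynomial (Fin (d + 1)) ℝ}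
    (hP : P.IsHomogeneous n) :
    fromBary d P ∈ Submodule.span ℝ (Set.range (bernstein d n)) := by
  rw [P.as_sum, map_sum]
  refine Submodule.sum_mem _ fun s hs => ?_
  have hdeg : ∑ j, s j = n := by
    have h := hP (mem_support_iff.1 hs)
    rwa [Pi.one_def, ← Finsupp.degree_eq_weight_one, Finsupp.degree_eq_sum] at h
  have hne : ((n.factorial : ℝ) / ∏ j, ((s j).factorial : ℝ)) ≠ 0 :=
    div_ne_zero (by positivity) (Finset.prod_ne_zero_iff.2 fun k _ => by positivity)
  have h : fromBary d (monomial s (coeff s P)) =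
      (coeff s P / ((n.factorial : ℝ) / ∏ j, ((s j).factorial : ℝ))) •
        bernstein d n ⟨⇑s, hdeg⟩ := by
    rw [fromBary_monomial, bernstein, smul_eq_C_mul, ← mul_assoc, ← C_mul, div_mul_cancel₀ _ hne]
  rw [h]
  exact Submodule.smul_mem _ _ (Submodule.subset_span ⟨_, rfl⟩)

/-- Homogenise by `x_i = 2 λ_i - ∑ λ_j`, then pad each monomial with powers of `∑ λ_j = 1` up to
degree exactly `n`. -/
lemma mem_span_bernstein {d n : ℕ} {p : MvPolynomial (Fin d) ℝ} (hp : p.totalDegree ≤ n) :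
    p ∈ Submodule.span ℝ (Set.range (bernstein d n)) := by
  rw [p.as_sum]
  refine Submodule.sum_mem _ fun s hs => ?_
  have hs' : ∑ i, s i ≤ n := by
    have h := (le_totalDegree hs).trans hp
    rwa [Finsupp.sum_fintype _ _ fun _ => rfl] at h
  have hS : IsHomogeneous (∑ j, X j : MvPolynomial (Fin (d + 1)) ℝ) 1 :=
    IsHomogeneous.sum _ _ _ fun j _ => isHomogeneous_X ℝ j
  have hlin : ∀ i : Fin d,
      IsHomogeneous (C 2 * X i.succ - ∑ j, X j : MvPolynomial (Fin (d + 1)) ℝ) 1 := fun i =>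
    ((isHomogeneous_X ℝ i.succ).C_mul 2).sub hS
  have hhom : IsHomogeneous (C (coeff s p) *
      ((∏ i, (C 2 * X i.succ - ∑ j, X j : MvPolynomial (Fin (d + 1)) ℝ) ^ s i) *
        (∑ j, X j) ^ (n - ∑ i, s i))) n := by
    have h1 := IsHomogeneous.prod Finset.univ
      (fun i => (C 2 * X i.succ - ∑ j, X j : MvPolynomial (Fin (d + 1)) ℝ) ^ s i)
      (fun i => 1 * s i) fun i _ => (hlin i).pow (s i)
    have h2 := (h1.mul (hS.pow (n - ∑ i, s i))).C_mul (coeff s p)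
    simp only [one_mul] at h2
    rwa [Nat.add_sub_cancel' hs'] at h2
  have himg := fromBary_mem_span_bernstein hhom
  have hsum : fromBary d (∑ j, X j) = 1 := by simp [fromBary, sum_bary]
  have hX : ∀ i : Fin d, fromBary d (C 2 * X i.succ - ∑ j, X j) = X i := by
    intro i
    rw [map_sub, hsum, map_mul]
    have h2 : (C 2 * C (1 / 2) : MvPolynomial (Fin d) ℝ) = 1 := by
      rw [← C_mul]; norm_num
    simp only [fromBary, aeval_X, bary, Fin.cons_succ, algHom_C, algebraMap_eq]
    linear_combination (1 + X i) * h2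
  rw [map_mul, map_mul, map_pow, hsum, one_pow, mul_one, map_prod] at himg
  simp only [map_pow, hX] at himg
  rw [monomial_eq, Finsupp.prod_fintype _ _ fun _ => pow_zero _]
  simpa [fromBary] using himg

variable {d : ℕ} {L : (Fin d → ℕ) → MvPolynomial (Fin d) ℝ}

lemma IsModalBasis.linearIndependent (hL : IsModalBasis d L) : LinearIndependent ℝ L := by
  refine LinearMap.linearIndependent_of_isOrthoᵢ (B := l2Form d) ?_ ?_
  · intro γ σ h
    change l2Inner d (L γ) (L σ) = 0
    rw [hL.orthonormal, if_neg h]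
  · intro γ
    change l2Inner d (L γ) (L γ) ≠ 0
    rw [hL.orthonormal, if_pos rfl]
    exact one_ne_zero

lemma IsModalBasis.linearIndependent_modalIdx (hL : IsModalBasis d L) (n : ℕ) :
    LinearIndependent ℝ fun γ : ModalIdx d n => L γ.1 :=
  hL.linearIndependent.comp _ Subtype.val_injective

/-- The independent modes lie in a span generated by equally many Bernstein polynomials.
Independence of the latter then follows by the same count. -/
lemma IsModalBasis.span_eq_span_bernstein (hL : IsModalBasis d L) (n : ℕ) :
    Submodule.span ℝ (Set.range fun γ : ModalIdx d n => L γ.1) =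
      Submodule.span ℝ (Set.range (bernstein d n)) := by
  have hle : Submodule.span ℝ (Set.range fun γ : ModalIdx d n => L γ.1) ≤
      Submodule.span ℝ (Set.range (bernstein d n)) := by
    rw [Submodule.span_le]
    rintro _ ⟨γ, rfl⟩
    exact mem_span_bernstein ((hL.hierarchical γ.1).trans γ.2)
  have := FiniteDimensional.span_of_finite ℝ (Set.finite_range (bernstein d n))
  refine Submodule.eq_of_le_of_finrank_le hle ?_
  rw [finrank_span_eq_card (hL.linearIndependent_modalIdx n),
    ← Fintype.card_congr (bernIdxEquivModalIdx d n)]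
  exact finrank_range_le_card _

lemma IsModalBasis.linearIndependent_bernstein (hL : IsModalBasis d L) (n : ℕ) :
    LinearIndependent ℝ (bernstein d n) := by
  rw [linearIndependent_iff_card_eq_finrank_span, Set.finrank, ← hL.span_eq_span_bernstein,
    finrank_span_eq_card (hL.linearIndependent_modalIdx n),
    Fintype.card_congr (bernIdxEquivModalIdx d n)]

lemma IsModalBasis.fromBary_bernHom_injective (hL : IsModalBasis d L) (n : ℕ) :
    Function.Injective fun c => fromBary d (bernHom d n c) := by
  intro c e h
  simp only [fromBary_bernHom] at h
  exact (hL.linearIndependent_bernstein n).fintypeLinearCombination_injective h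

lemma IsModalBasis.fromBary_bernHom_mem (hL : IsModalBasis d L) {n : ℕ} (c : BernIdx d n → ℝ) :
    fromBary d (bernHom d n c) ∈ Submodule.span ℝ (Set.range fun γ : ModalIdx d n => L γ.1) := by
  rw [hL.span_eq_span_bernstein, fromBary_bernHom]
  exact Submodule.sum_mem _ fun β _ => Submodule.smul_mem _ _ (Submodule.subset_span ⟨β, rfl⟩)

lemma IsModalBasis.exists_bernHom_eq (hL : IsModalBasis d L) {n : ℕ} (γ : ModalIdx d n) :
    ∃ c : BernIdx d n → ℝ, fromBary d (bernHom d n c) = L γ.1 := by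
  have h : L γ.1 ∈ Submodule.span ℝ (Set.range (bernstein d n)) :=
    mem_span_bernstein ((hL.hierarchical γ.1).trans γ.2)
  rw [Submodule.mem_span_range_iff_exists_fun] at h
  simpa only [fromBary_bernHom] using h

end Spans

/-! ### Modes as eigenvectors of `E Eᵀ`. -/

section Eigen

variable {d : ℕ} {L : (Fin d → ℕ) → MvPolynomial (Fin d) ℝ}

lemma IsModalBasis.l2Form_eq (hL : IsModalBasis d L) (γ σ : Fin d → ℕ) :
    l2Form d (L γ) (L σ) = if γ = σ then 1 else 0 :=
  hL.orthonormal γ σ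

lemma IsModalBasis.l2Form_bernHom_eq_zero (hL : IsModalBasis d L) {n : ℕ} (c : BernIdx d n → ℝ)
    {σ : Fin d → ℕ} (hσ : n < ∑ j, σ j) :
    l2Form d (fromBary d (bernHom d n c)) (L σ) = 0 := by
  obtain ⟨a, ha⟩ := (Submodule.mem_span_range_iff_exists_fun ℝ).1 (hL.fromBary_bernHom_mem c)
  rw [← ha]
  simp only [map_sum, LinearMap.sum_apply, map_smul, LinearMap.smul_apply, hL.l2Form_eq]
  refine Finset.sum_eq_zero fun γ _ => ?_
  rw [if_neg, smul_zero]
  rintro rfl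
  exact absurd γ.2 (not_le.2 hσ)

lemma IsModalBasis.l2Form_baryLaplace_eq_zero (hL : IsModalBasis d L) {n : ℕ}
    (c : BernIdx d n → ℝ) {σ : Fin d → ℕ} (hσ : n ≤ ∑ j, σ j) :
    l2Form d (fromBary d (baryLaplace d (bernHom d n c))) (L σ) = 0 := by
  obtain rfl | hn := eq_or_ne n 0
  · rw [baryLaplace_bernHom_zero]
    simp
  · rw [baryLaplace_bernHom hn, map_smul, map_smul, LinearMap.smul_apply,
      hL.l2Form_bernHom_eq_zero _ (by omega), smul_zero]

lemma IsModalBasis.fromBary_baryLaplace_mem (hL : IsModalBasis d L) {n : ℕ}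
    (c : BernIdx d n → ℝ) :
    fromBary d (baryLaplace d (bernHom d n c)) ∈
      Submodule.span ℝ (Set.range fun γ : ModalIdx d n => L γ.1) := by
  obtain rfl | hn := eq_or_ne n 0
  · rw [baryLaplace_bernHom_zero, map_zero]
    exact Submodule.zero_mem _
  · rw [baryLaplace_bernHom hn, map_smul, ← fromBary_bernHom_elevOne hn]
    exact Submodule.smul_mem _ _ (hL.fromBary_bernHom_mem _)

lemma IsModalBasis.eq_smul_of_l2Form (hL : IsModalBasis d L) {n : ℕ} {p : MvPolynomial (Fin d) ℝ}
    (hp : p ∈ Submodule.span ℝ (Set.range fun γ : ModalIdx d n => L γ.1)) (γ : ModalIdx d n)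
    {μ : ℝ} (h : ∀ σ : ModalIdx d n, l2Form d p (L σ.1) = if γ = σ then μ else 0) :
    p = μ • L γ.1 := by
  obtain ⟨a, rfl⟩ := (Submodule.mem_span_range_iff_exists_fun ℝ).1 hp
  have ha : ∀ σ, a σ = if γ = σ then μ else 0 := by
    intro σ
    rw [← h σ]
    simp [hL.l2Form_eq, ← Subtype.ext_iff]
  simp [ha]

/-- The modes of degree `k` are eigenfunctions of `∑_j ∂_j λ_j ∂_j` on homogeneous
representatives of degree `n`. -/
lemma IsModalBasis.baryLaplace_eigen (hL : IsModalBasis d L) {n : ℕ} (γ : ModalIdx d n)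
    {c : BernIdx d n → ℝ} (hc : fromBary d (bernHom d n c) = L γ.1) :
    fromBary d (baryLaplace d (bernHom d n c)) =
      ((n : ℝ) * (n + d) - (∑ j, γ.1 j : ℕ) * ((∑ j, γ.1 j : ℕ) + d)) • L γ.1 := by
  refine hL.eq_smul_of_l2Form (hL.fromBary_baryLaplace_mem c) γ fun σ => ?_
  obtain hσ | hσ := le_or_gt (∑ j, σ.1 j) (∑ j, γ.1 j)
  -- With `L_σ` written in its own degree, the operator sends it below degree `|γ|`, so the adjoint
  -- term vanishes.
  · obtain ⟨e, he⟩ := hL.exists_bernHom_eq (n := ∑ j, σ.1 j) ⟨σ.1, le_rfl⟩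
    have h := l2Form_baryLaplace_bernHom c e
    rw [l2Form_comm (fromBary d (bernHom d n c)), hc, hL.l2Form_baryLaplace_eq_zero e hσ, he,
      sub_zero, hL.l2Form_eq] at h
    rw [h]
    by_cases hγ : γ = σ
    · subst hγ
      simp
    · simp [hγ, ← Subtype.ext_iff]
  -- Here `|σ| > |γ|`. In equal degree `n` the operator is symmetric and can be moved onto `L_σ`;
  -- then `L_γ` is rewritten in its own degree `|γ|` and the operator moved back, where the image is
  -- orthogonal to `L_σ`.
  · obtain ⟨e, he⟩ := hL.exists_bernHom_eq σ
    obtain ⟨c', hc'⟩ := hL.exists_bernHom_eq (n := ∑ j, γ.1 j) ⟨γ.1, le_rfl⟩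
    have hne : γ ≠ σ := by
      rintro rfl
      exact lt_irrefl _ hσ
    have h1 := l2Form_baryLaplace_bernHom c e
    have h2 := l2Form_baryLaplace_bernHom e c'
    rw [sub_self, zero_mul, sub_eq_zero, he, hc, l2Form_comm (L γ.1)] at h1
    rw [l2Form_comm _ (fromBary d (baryLaplace d (bernHom d _ c'))), he, hc',
      hL.l2Form_baryLaplace_eq_zero c' hσ.le, hL.l2Form_eq,
      if_neg fun h => hne (Subtype.ext h.symm), mul_zero, sub_zero] at h2
    rw [h1, h2, if_neg hne]

/-- The eigenvalue of `E^n_{n-i} (E^n_{n-i})ᵀ` on the modes of degree `k`. -/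
def elevEigenvalue (d n i k : ℕ) : ℝ :=
  ∏ m ∈ Finset.range i,
    (((n - m : ℕ) : ℝ) * ((n - m : ℕ) + d) - (k : ℝ) * (k + d)) / ((n - m : ℕ) : ℝ) ^ 2

lemma elevEigenvalue_eq_zero {d n i k : ℕ} (hk : k ≤ n) (h : n < i + k) :
    elevEigenvalue d n i k = 0 := by
  refine Finset.prod_eq_zero (i := n - k) (Finset.mem_range.2 (by omega)) ?_
  rw [Nat.sub_sub_self hk, sub_self, zero_div]

lemma elevEigenvalue_ne_zero {d n i k : ℕ} (h : i + k ≤ n) : elevEigenvalue d n i k ≠ 0 := by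
  refine Finset.prod_ne_zero_iff.2 fun m hm => ?_
  have hm' := Finset.mem_range.1 hm
  have hlt : (k : ℝ) < (n - m : ℕ) := by
    exact_mod_cast (by omega : k < n - m)
  have h0 : (0 : ℝ) ≤ k := Nat.cast_nonneg k
  have hd : (0 : ℝ) ≤ d := Nat.cast_nonneg d
  refine div_ne_zero (ne_of_gt ?_) (pow_ne_zero _ (by linarith))
  nlinarith

lemma IsModalBasis.bernHom_transpose_elev (hL : IsModalBasis d L) {n : ℕ} (γ : ModalIdx d n)
    {v : BernIdx d n → ℝ} (hv : fromBary d (bernHom d n v) = L γ.1) {i : ℕ} (hi : i ≤ n) :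
    fromBary d (bernHom d (n - i) ((elev d n i)ᵀ *ᵥ v)) =
      elevEigenvalue d n i (∑ j, γ.1 j) • L γ.1 := by
  induction i with
  | zero => simpa [elev, elevEigenvalue] using hv
  | succ i ih =>
    have ih := ih (Nat.le_of_succ_le hi)
    have hn : n - i ≠ 0 := by omega
    have hn' : ((n - i : ℕ) : ℝ) ≠ 0 := Nat.cast_ne_zero.2 hn
    set w := (elev d n i)ᵀ *ᵥ v with hw
    have hstep : (elev d n (i + 1))ᵀ *ᵥ v = (elevOne d (n - i))ᵀ *ᵥ w := by
      rw [hw, mulVec_mulVec, ← transpose_mul]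
      rfl
    have key : fromBary d (baryLaplace d (bernHom d (n - i) w)) =
        (((n - i : ℕ) : ℝ) * ((n - i : ℕ) + d) -
          (∑ j, γ.1 j : ℕ) * ((∑ j, γ.1 j : ℕ) + d)) •
            elevEigenvalue d n i (∑ j, γ.1 j) • L γ.1 := by
      -- If `L_γ` still fits in degree `n - i`, injectivity makes `w` a multiple of its coefficient
      -- vector. Otherwise the eigenvalue is already 0, and so is `w`.
      obtain hk | hk := le_or_gt (∑ j, γ.1 j) (n - i)
      · obtain ⟨c, hc⟩ := hL.exists_bernHom_eq (n := n - i) ⟨γ.1, hk⟩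
        have hwc : w = elevEigenvalue d n i (∑ j, γ.1 j) • c := by
          apply hL.fromBary_bernHom_injective
          simp only [map_smul, hc, ih]
        rw [hwc, map_smul, map_smul, map_smul, hL.baryLaplace_eigen ⟨γ.1, hk⟩ hc, smul_comm]
      · have hw0 : w = 0 := by
          apply hL.fromBary_bernHom_injective
          simp only [ih, map_zero, elevEigenvalue_eq_zero γ.2 (by omega : n < i + _), zero_smul]
        rw [hw0, elevEigenvalue_eq_zero γ.2 (by omega : n < i + _)]
        simp
    rw [baryLaplace_bernHom hn, map_smul, ← hstep] at key
    have hpow : ((n - i : ℕ) : ℝ) ^ 2 ≠ 0 := pow_ne_zero _ hn'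
    have key' := (eq_inv_smul_iff₀ hpow).2 key
    refine Eq.trans key' ?_
    rw [smul_smul, smul_smul, elevEigenvalue, elevEigenvalue, Finset.prod_range_succ]
    congr 1
    field_simp

lemma fromBary_bernHom_elev {n i : ℕ} (hi : i ≤ n) (a : BernIdx d (n - i) → ℝ) :
    fromBary d (bernHom d n (elev d n i *ᵥ a)) = fromBary d (bernHom d (n - i) a) := by
  induction i with
  | zero => simp [elev]
  | succ i ih =>
    have h : elev d n (i + 1) *ᵥ a = elev d n i *ᵥ (elevOne d (n - i) *ᵥ a) := by
      rw [mulVec_mulVec]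
      rfl
    rw [h, ih (Nat.le_of_succ_le hi)]
    exact fromBary_bernHom_elevOne (Nat.sub_ne_zero_of_lt hi) a

lemma IsModalBasis.elev_mul_transpose_mulVec (hL : IsModalBasis d L) {n : ℕ} (γ : ModalIdx d n)
    {v : BernIdx d n → ℝ} (hv : fromBary d (bernHom d n v) = L γ.1) {i : ℕ} (hi : i ≤ n) :
    (elev d n i * (elev d n i)ᵀ) *ᵥ v = elevEigenvalue d n i (∑ j, γ.1 j) • v := by
  apply hL.fromBary_bernHom_injective
  simp only
  rw [← mulVec_mulVec, fromBary_bernHom_elev hi, hL.bernHom_transpose_elev γ hv hi, map_smul,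
    map_smul, hv]

end Eigen

/-! ### Triangularity of the eigenvalue table. -/

section Basis

/-- Block-scalar diagonal matrices are parametrised by their block values, listed from the
highest degree to the lowest. -/
def blockScalarMap (d n : ℕ) : (Fin (n + 1) → ℝ) →ₗ[ℝ] blockScalar d n where
  toFun c := ⟨Matrix.diagonal fun γ : ModalIdx d n => c (Fin.ofNat (n + 1) (n - ∑ j, γ.1 j)),
    fun k => c (Fin.ofNat (n + 1) (n - k)), rfl⟩
  map_add' _ _ := Subtype.ext (Matrix.diagonal_add _ _).symm
  map_smul' r _ := Subtype.ext (Matrix.diagonal_smul r _)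

lemma blockScalarMap_bijective {d : ℕ} (hd : 1 ≤ d) (n : ℕ) :
    Function.Bijective (blockScalarMap d n) := by
  constructor
  · intro a b h
    funext i
    -- A mode of degree `n - i` reads off the value at `i`; since `d ≥ 1`, every degree up to `n` is
    -- attained.
    have hsum : ∑ j, (Pi.single (⟨0, hd⟩ : Fin d) (n - i : ℕ) : Fin d → ℕ) j = n - i := by simp
    have h1 := congrFun (congrFun (congrArg Subtype.val h)
      ⟨Pi.single ⟨0, hd⟩ (n - i), hsum.trans_le (Nat.sub_le _ _)⟩)
      ⟨Pi.single ⟨0, hd⟩ (n - i), hsum.trans_le (Nat.sub_le _ _)⟩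
    have hi : Fin.ofNat (n + 1) (n - (n - i)) = i := by
      ext
      simp only [Fin.val_ofNat]
      rw [Nat.mod_eq_of_lt] <;> omega
    simpa only [blockScalarMap, LinearMap.coe_mk, AddHom.coe_mk, Matrix.diagonal_apply_eq, hsum,
      hi] using h1
  · rintro ⟨_, c, rfl⟩
    refine ⟨fun i => c (n - i), Subtype.ext ?_⟩
    simp only [blockScalarMap, LinearMap.coe_mk, AddHom.coe_mk]
    congr 1
    funext γ
    have := γ.2
    congr 1
    simp only [Fin.val_ofNat]
    rw [Nat.mod_eq_of_lt] <;> omega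

/-- Column `k` stands for modal degree `n - k`: entries with `k < i` contain the zero factor, and
the diagonal ones do not. -/
lemma linearIndependent_elevEigenvalue (d n : ℕ) :
    LinearIndependent ℝ fun i k : Fin (n + 1) => elevEigenvalue d n i (n - k) := by
  let M : Matrix (Fin (n + 1)) (Fin (n + 1)) ℝ :=
    Matrix.of fun i k => elevEigenvalue d n i (n - k)
  have hM : M.BlockTriangular id := by
    intro i k hik
    have : (k : ℕ) < i := hik
    exact elevEigenvalue_eq_zero (Nat.sub_le _ _) (by omega)
  have hdet : IsUnit M.det := by
    rw [Matrix.det_of_isUpperTriangular hM, isUnit_iff_ne_zero]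
    refine Finset.prod_ne_zero_iff.2 fun i _ => elevEigenvalue_ne_zero ?_
    omega
  exact Matrix.linearIndependent_rows_of_isUnit ((Matrix.isUnit_iff_isUnit_det M).2 hdet)

/-- The diagonal matrices of eigenvalues of `E^n_{n-i} (E^n_{n-i})ᵀ`, `0 ≤ i ≤ n`, form a basis
of the block-scalar matrices. -/
lemma exists_basis_blockScalar {d : ℕ} (hd : 1 ≤ d) (n : ℕ) :
    ∃ b : Module.Basis (Fin (n + 1)) ℝ (blockScalar d n), ∀ i : Fin (n + 1),
      (b i : Matrix (ModalIdx d n) (ModalIdx d n) ℝ) =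
        Matrix.diagonal fun γ => elevEigenvalue d n i (∑ j, γ.1 j) := by
  refine ⟨(basisOfLinearIndependentOfCardEqFinrank (linearIndependent_elevEigenvalue d n)
    (by simp)).map (LinearEquiv.ofBijective _ (blockScalarMap_bijective hd n)), fun i => ?_⟩
  simp only [Module.Basis.map_apply, coe_basisOfLinearIndependentOfCardEqFinrank,
    LinearEquiv.ofBijective_apply, blockScalarMap, LinearMap.coe_mk, AddHom.coe_mk]
  congr 1
  funext γ
  have := γ.2
  congr 1
  simp only [Fin.val_ofNat]
  rw [Nat.mod_eq_of_lt] <;> omega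

end Basis

/-! ### The modal-to-Bernstein matrix and diagonalisation. -/

section Transform

variable {d n : ℕ} {L : (Fin d → ℕ) → MvPolynomial (Fin d) ℝ}

lemma isModalToBernstein_iff {T : Matrix (BernIdx d n) (ModalIdx d n) ℝ} :
    IsModalToBernstein d n L T ↔
      ∀ γ, fromBary d (bernHom d n fun α => T α γ) = L γ.1 := by
  simp only [IsModalToBernstein, ← fromBary_bernHom]
  constructor
  · intro h γ
    have h1 := h (Pi.single γ 1)
    simp only [Pi.single_apply, ite_smul, one_smul, zero_smul, Finset.sum_ite_eq',
      Finset.mem_univ, if_true, Matrix.mulVec_single_one] at h1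
    exact h1.symm
  · intro h c
    have hT : T *ᵥ c = ∑ γ, c γ • fun α => T α γ := by
      funext α
      simp [mulVec, dotProduct, mul_comm]
    rw [hT]
    simp only [map_sum, map_smul, h]

lemma IsModalBasis.existsUnique_isModalToBernstein (hL : IsModalBasis d L) :
    ∃! T : Matrix (BernIdx d n) (ModalIdx d n) ℝ, IsModalToBernstein d n L T := by
  choose t ht using fun γ : ModalIdx d n => hL.exists_bernHom_eq γ
  refine ⟨Matrix.of fun α γ => t γ α, isModalToBernstein_iff.2 ht, fun T hT => ?_⟩
  have hT := isModalToBernstein_iff.1 hT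
  ext α γ
  exact congrFun (hL.fromBary_bernHom_injective n ((hT γ).trans (ht γ).symm)) α

lemma IsModalBasis.exists_inverse (hL : IsModalBasis d L)
    {T : Matrix (BernIdx d n) (ModalIdx d n) ℝ} (hT : IsModalToBernstein d n L T) :
    ∃ S : Matrix (ModalIdx d n) (BernIdx d n) ℝ, S * T = 1 ∧ T * S = 1 := by
  have hex : ∀ α : BernIdx d n, ∃ s : ModalIdx d n → ℝ, T *ᵥ s = Pi.single α 1 := by
    intro α
    obtain ⟨s, hs⟩ := (Submodule.mem_span_range_iff_exists_fun ℝ).1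
      (hL.fromBary_bernHom_mem (Pi.single α (1 : ℝ)))
    refine ⟨s, hL.fromBary_bernHom_injective n ?_⟩
    simp only
    rw [← hs, hT s, fromBary_bernHom]
  choose s hs using hex
  have h : T * (Matrix.of fun γ α => s α γ) = 1 := by
    ext β α
    refine (congrFun (hs α) β).trans ?_
    rw [Matrix.one_apply, Pi.single_apply]
  -- The two index types are in bijection, so the right inverse is two-sided.
  exact ⟨_, (Matrix.mul_eq_one_comm_of_equiv (bernIdxEquivModalIdx d n)).1 h, h⟩

lemma IsModalBasis.elev_mul_transpose_mul (hL : IsModalBasis d L)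
    {T : Matrix (BernIdx d n) (ModalIdx d n) ℝ} (hT : IsModalToBernstein d n L T) {i : ℕ}
    (hi : i ≤ n) :
    elev d n i * (elev d n i)ᵀ * T =
      T * Matrix.diagonal fun γ : ModalIdx d n => elevEigenvalue d n i (∑ j, γ.1 j) := by
  ext α γ
  rw [Matrix.mul_diagonal, mul_comm]
  exact congrFun (hL.elev_mul_transpose_mulVec γ (isModalToBernstein_iff.1 hT γ) hi) α

end Transform

end

end BernsteinModal

theorem mainTheorem3 (d N : ℕ) (hd : 1 ≤ d)
    (L : (Fin d → ℕ) → MvPolynomial (Fin d) ℝ) (hL : BernsteinModal.IsModalBasis d L) :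
    (∃! T : Matrix (BernsteinModal.BernIdx d N) (BernsteinModal.ModalIdx d N) ℝ,
      BernsteinModal.IsModalToBernstein d N L T) ∧
    ∀ T : Matrix (BernsteinModal.BernIdx d N) (BernsteinModal.ModalIdx d N) ℝ,
      BernsteinModal.IsModalToBernstein d N L T →
      ∃ Tinv : Matrix (BernsteinModal.ModalIdx d N) (BernsteinModal.BernIdx d N) ℝ,
        Tinv * T = 1 ∧ T * Tinv = 1 ∧
        ∃ b : Module.Basis (Fin (N + 1)) ℝ (BernsteinModal.blockScalar d N),
          ∀ i : Fin (N + 1),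
            (b i : Matrix (BernsteinModal.ModalIdx d N) (BernsteinModal.ModalIdx d N) ℝ) =
              Tinv * (BernsteinModal.elev d N i * (BernsteinModal.elev d N i).transpose) * T := by
  refine ⟨hL.existsUnique_isModalToBernstein, fun T hT => ?_⟩
  obtain ⟨S, hST, hTS⟩ := hL.exists_inverse hT
  obtain ⟨b, hb⟩ := BernsteinModal.exists_basis_blockScalar hd N
  refine ⟨S, hST, hTS, b, fun i => ?_⟩
  rw [hb, Matrix.mul_assoc S, hL.elev_mul_transpose_mul hT (Nat.le_of_lt_succ i.2),
    ← Matrix.mul_assoc, hST, Matrix.one_mul]
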